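/- All lattices are finite. The order dimension $\dim(P)$ of a finite poset $P$ is the smallest integer $k\ge 0$ such that $P$ is isomorphic to a subposet of $\mathbb{R}^k$ with the componentwise order. A lattice $L$ is extremal if the maximal length of a chain of $L$ (a chain of $k+1$ elements has length $k$) is equal both to the number of its join-irreducible elements (those that cover exactly one element) and to the number of its meet-irreducible elements (those that are covered by exactly one element). A longest chain $x_0<x_1<\dots<x_N$ of an extremal lattice $L$ then gives numberings $j_1,\dots,j_N$ of the join-irreducibles and $m_1,\dots,m_N$ of the meet-irreducibles such that $x_i=j_1\vee\dots\vee j_i=m_{i+1}\wedge\dots\wedge m_N$ for all $i$. The Galois graph of $L$ is the directed graph on the join-irreducibles with an edge $j_i\to j_k$ if $i\ne k$ and $j_i\not\le m_k$; it does not depend on the chain. For $m,n\ge 0$, let $X=\{x_1,\dots,x_m\}$ and $Y=\{y_1,\dots,y_n\}$ be disjoint alphabets, and let $G_{m,n}$ be the directed graph with vertex set $X\sqcup Y\sqcup (X\times Y)$ and an edge $l_1\to l_2$ if $l_1\neq l_2$ and either - $l_1=(x_s,y_t)$ and $l_2=x_s$, or - $l_1=y_t$ and $l_2=(x_s,y_t)$,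 or - $l_1=(x_s,y_t)$ and $l_2=(x_{s'},y_{t'})$ with $s\ge s'$ and $t\le t'$. The bubble lattice $\mathrm{Bub}(m,n)$ is the extremal lattice whose Galois graph is isomorphic to $G_{m,n}$. Concretely, it is the lattice of maximal orthogonal pairs of $G_{m,n}$, that is, of the pairs $(A,B)$ of disjoint sets of vertices with no edge from $A$ to $B$ that are maximal for componentwise inclusion among such pairs, ordered by $(A,B)\le (A',B')$ if $A\subseteq A'$. **Proposition.** For all $m,n\ge 0$, the lattice of maximal orthogonal pairs of $G_{m,n}$ is a finite extremal lattice whose Galois graph is isomorphic to $G_{m,n}$, and every finite extremal lattice $L$ whose Galois graph is isomorphic to $G_{m,n}$ has order dimension $m+n$. In other words, $\mathrm{Bub}(m,n)$ exists and $$\dim(\mathrm{Bub}(m,n))=m+n .$$ -/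

import Mathlib

namespace BubbleLattices

universe u v

/-- `P` has order dimension `d`: `d` is the smallest natural number `k` such that `P` is isomorphic
to a subposet of `ℝᵏ` with the componentwise order. -/
def HasOrderDim (P : Type u) [PartialOrder P] (d : ℕ) : Prop :=
  IsLeast {k : ℕ | Nonempty (P ↪o (Fin k → ℝ))} d

/-- The join-irreducible elements: those that cover exactly one element. -/
def JIrr (L : Type u) [Lattice L] : Set L := {j | ∃! y, y ⋖ j}

/-- The meet-irreducible elements: those that are covered by exactly one element. -/
def MIrr (L : Type u) [Lattice L] : Set L := {a | ∃! y, a ⋖ y}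

/-- A (finite) lattice is extremal if its length (the maximal length of a chain, where a chain of
`k + 1` elements has length `k`) is equal to the number of its join-irreducible elements and to the
number of its meet-irreducible elements. -/
def IsExtremal (L : Type u) [Lattice L] : Prop :=
  Order.krullDim L = ((JIrr L).ncard : WithBot ℕ∞) ∧
    Order.krullDim L = ((MIrr L).ncard : WithBot ℕ∞)

/-- A longest chain `x₀ < ⋯ < x_N` of `L` with the numbering `j₁, …, j_N` of the join-irreducibles
and the numbering `m₁, …, m_N` of the meet-irreducibles that it gives, which are such that
`xᵢ = j₁ ∨ ⋯ ∨ jᵢ = mᵢ₊₁ ∧ ⋯ ∧ m_N` for all `i`. The numberings are indexed from `0` below: `jᵢ₊₁`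
is `join i` and `mᵢ₊₁` is `meet i`. -/
structure ChainNumbering (L : Type u) [Lattice L] (N : ℕ) where
  chain : Fin (N + 1) → L
  strictMono_chain : StrictMono chain
  longest : Order.krullDim L = (N : WithBot ℕ∞)
  join : Fin N → L
  join_injective : Function.Injective join
  range_join : Set.range join = JIrr L
  meet : Fin N → L
  meet_injective : Function.Injective meet
  range_meet : Set.range meet = MIrr L
  isLUB_join : ∀ i : Fin (N + 1), IsLUB (join '' {k | k.castSucc < i}) (chain i)
  isGLB_meet : ∀ i : Fin (N + 1), IsGLB (meet '' {k | i ≤ k.castSucc}) (chain i)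

/-- The Galois graph of an extremal lattice: its vertices are the join-irreducible elements, and
there is an edge `jᵢ → jₖ` if `i ≠ k` and `jᵢ ≰ mₖ`. The pairing of `jₖ` with `mₖ`
does not depend on the longest chain. -/
def galoisGraph (L : Type u) [Lattice L] : Digraph (JIrr L) where
  Adj a b := ∃ (N : ℕ) (c : ChainNumbering L N) (i k : Fin N),
    c.join i = a ∧ c.join k = b ∧ i ≠ k ∧ ¬ c.join i ≤ c.meet k

/-- The set `X ⊔ Y ⊔ (X × Y)` for the disjoint alphabets `X = {x₁, …, x_m}`
and `Y = {y₁, …, y_n}`. -/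
inductive Vertex (m n : ℕ) : Type
  | x (s : Fin m) : Vertex m n
  | y (t : Fin n) : Vertex m n
  | xy (s : Fin m) (t : Fin n) : Vertex m n

/-- The directed graph on `X ⊔ Y ⊔ (X × Y)` that defines the bubble lattice: `l₁ → l₂` if `l₁ ≠ l₂`
and `l₁ = (x_s, y_t)`, `l₂ = x_s`, or `l₁ = y_t`, `l₂ = (x_s, y_t)`, or
`l₁ = (x_s, y_t)`, `l₂ = (x_{s'}, y_{t'})` with `s ≥ s'` and `t ≤ t'`. -/
def bubbleGraph (m n : ℕ) : Digraph (Vertex m n) where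
  Adj l₁ l₂ := l₁ ≠ l₂ ∧
    ((∃ s t, l₁ = .xy s t ∧ l₂ = .x s) ∨
      (∃ s t, l₁ = .y t ∧ l₂ = .xy s t) ∨
      (∃ s t s' t', l₁ = .xy s t ∧ l₂ = .xy s' t' ∧ s' ≤ s ∧ t ≤ t'))

/-- `L` is a bubble lattice `Bub(m, n)`: it is a finite extremal lattice whose Galois graph is
isomorphic to the directed graph above. -/
structure IsBubbleLattice (m n : ℕ) (L : Type u) [Lattice L] : Prop where
  finite : Finite L
  extremal : IsExtremal L
  galois : Nonempty ((galoisGraph L).Adj ≃r (bubbleGraph m n).Adj)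

/-- A pair of disjoint sets of vertices with no directed edge from the first to the second. -/
def IsOrthogonal {V : Type v} (G : Digraph V) (p : Set V × Set V) : Prop :=
  Disjoint p.1 p.2 ∧ ∀ a ∈ p.1, ∀ b ∈ p.2, ¬ G.Adj a b

/-- The maximal orthogonal pairs of a directed graph. -/
def MaxOrthPair {V : Type v} (G : Digraph V) : Type v :=
  {p : Set V × Set V // Maximal (IsOrthogonal G) p}

namespace MaxOrthPair

variable {V : Type v} {G : Digraph V}

/-- `a` and `b` are different and there is no edge from `a` to `b`. -/
def Rel (G : Digraph V) (a b : V) : Prop := a ≠ b ∧ ¬ G.Adj a b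

theorem isOrthogonal_iff (p : Set V × Set V) :
    IsOrthogonal G p ↔ ∀ a ∈ p.1, ∀ b ∈ p.2, Rel G a b := by
  unfold IsOrthogonal Rel
  rw [Set.disjoint_iff_forall_ne]
  constructor
  · rintro ⟨h₁, h₂⟩ a ha b hb
    exact ⟨h₁ ha hb, h₂ a ha b hb⟩
  · intro h
    exact ⟨fun a ha b hb => (h a ha b hb).1, fun a ha b hb => (h a ha b hb).2⟩

theorem maximal_iff (p : Set V × Set V) : Maximal (IsOrthogonal G) p ↔
    upperPolar (Rel G) p.1 = p.2 ∧ lowerPolar (Rel G) p.2 = p.1 := by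
  obtain ⟨X, Y⟩ := p
  constructor
  · rintro ⟨ho, hm⟩
    rw [isOrthogonal_iff] at ho
    constructor
    · refine Set.Subset.antisymm ?_ fun b hb a ha => ho a ha b hb
      have h : IsOrthogonal G (X, upperPolar (Rel G) X) := by
        rw [isOrthogonal_iff]
        exact fun a ha b hb => hb ha
      exact (hm h ⟨le_rfl, fun b hb a ha => ho a ha b hb⟩).2
    · refine Set.Subset.antisymm ?_ fun a ha b hb => ho a ha b hb
      have h : IsOrthogonal G (lowerPolar (Rel G) Y, Y) := by
        rw [isOrthogonal_iff]
        exact fun a ha b hb => ha hb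
      exact (hm h ⟨fun a ha b hb => ho a ha b hb, le_rfl⟩).1
  · rintro ⟨h₁, h₂⟩
    dsimp only at h₁ h₂
    refine ⟨?_, ?_⟩
    · rw [isOrthogonal_iff]
      intro a ha b hb
      have hb' : b ∈ upperPolar (Rel G) X := h₁ ▸ hb
      exact hb' ha
    · rintro ⟨X', Y'⟩ ho ⟨hX, hY⟩
      rw [isOrthogonal_iff] at ho
      refine ⟨fun a ha => ?_, fun b hb => ?_⟩
      · change a ∈ X
        rw [← h₂]
        exact fun b hb => ho a ha b (hY hb)
      · change b ∈ Y
        rw [← h₁]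
        exact fun a ha => ho a (hX ha) b hb

/-- Maximal orthogonal pairs are the formal concepts of the relation `Rel G`. -/
def equivConcept (G : Digraph V) : MaxOrthPair G ≃ Concept V V (Rel G) where
  toFun p := ⟨p.1.1, p.1.2, ((maximal_iff p.1).1 p.2).1, ((maximal_iff p.1).1 p.2).2⟩
  invFun c := ⟨(c.extent, c.intent), (maximal_iff _).2 ⟨c.upperPolar_extent, c.lowerPolar_intent⟩⟩
  left_inv _ := rfl
  right_inv _ := rfl

/-- The order on maximal orthogonal pairs: `(X, Y) ≤ (X', Y')` if `X ⊆ X'`. -/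
instance : PartialOrder (MaxOrthPair G) where
  le p q := p.1.1 ⊆ q.1.1
  le_refl _ := Set.Subset.rfl
  le_trans _ _ _ h₁ h₂ := Set.Subset.trans h₁ h₂
  le_antisymm _ _ h₁ h₂ :=
    (equivConcept G).injective (Concept.ext (Set.Subset.antisymm h₁ h₂))

/-- For this order, the maximal orthogonal pairs form a lattice. -/
instance : Lattice (MaxOrthPair G) where
  sup p q := (equivConcept G).symm (equivConcept G p ⊔ equivConcept G q)
  inf p q := (equivConcept G).symm (equivConcept G p ⊓ equivConcept G q)
  le_sup_left p q :=
    (le_sup_left : equivConcept G p ≤ equivConcept G p ⊔ equivConcept G q)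
  le_sup_right p q :=
    (le_sup_right : equivConcept G q ≤ equivConcept G p ⊔ equivConcept G q)
  sup_le p q r h₁ h₂ :=
    (sup_le h₁ h₂ : equivConcept G p ⊔ equivConcept G q ≤ equivConcept G r)
  inf_le_left p q :=
    (inf_le_left : equivConcept G p ⊓ equivConcept G q ≤ equivConcept G p)
  inf_le_right p q :=
    (inf_le_right : equivConcept G p ⊓ equivConcept G q ≤ equivConcept G q)
  le_inf p q r h₁ h₂ :=
    (le_inf h₁ h₂ : equivConcept G p ≤ equivConcept G q ⊓ equivConcept G r)

end MaxOrthPair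

/-- The bubble lattice `Bub(m, n)`, built as the lattice of maximal orthogonal pairs of its
Galois graph. -/
abbrev Bub (m n : ℕ) : Type := MaxOrthPair (bubbleGraph m n)

end BubbleLattices

namespace BubbleLattices

universe u v

/-! ### Irreducibles and chains in finite lattices -/

section FiniteLattice

variable {L : Type u} [Lattice L]

/-! The proof reduces everything to one lattice, whose dimension is bounded from both sides by
reading the graph.

Reduction: in an extremal lattice the incidence `j i ≤ m k` holds for `i < k` and fails for `i = k`,
so the Galois graph records exactly when `j i ≤ m k`. A finite lattice is determined by this
incidence, hence is the lattice of maximal orthogonal pairs of its Galois graph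
(`IsExtremal.nonempty_orderIso`). Conversely, an acyclic graph can be numbered so that the incidence
is triangular, which forces extremality (`exists_chainNumbering_of_triangular`,
`MaxOrthPair.isExtremal_and_galoisGraph`).

Upper bound: the non-incident pairs are covered by `m + n` Ferrers relations, one for each letter,
and each gives a real coordinate (`MaxOrthPair.nonempty_orderEmbedding_of_ferrers`). Lower bound: no
edge joins two letters, so the letters yield a standard example of size `m + n`
(`card_le_of_standardExample`). -/

theorem exists_mem_JIrr_le_not_le [Finite L] {a b : L} (h : ¬a ≤ b) :
    ∃ j ∈ JIrr L, j ≤ a ∧ ¬j ≤ b := by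
  -- For a minimal such `j`, everything strictly below `j` lies below `b ⊓ j < j`, so `j` has a
  -- single lower cover.
  obtain ⟨j, ⟨hja, hjb⟩, hmin⟩ :=
    (Set.toFinite {x : L | x ≤ a ∧ ¬x ≤ b}).exists_minimal ⟨a, le_rfl, h⟩
  have hlt : ∀ z, z < j → z ≤ b := by
    intro z hz
    by_contra hzb
    exact hz.not_ge (hmin ⟨hz.le.trans hja, hzb⟩ hz.le)
  have hinf : b ⊓ j < j := inf_lt_right.2 hjb
  obtain ⟨y, hy, hyj⟩ := exists_le_covBy_of_lt hinf
  refine ⟨j, ⟨y, hyj, fun z hz => ?_⟩, hja, hjb⟩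
  have hzy : z ≤ y := (le_inf (hlt z hz.lt) hz.le).trans hy
  exact hzy.eq_of_not_lt fun hlt' => hz.2 hlt' hyj.lt

theorem MIrr_eq_JIrr_dual : MIrr L = OrderDual.toDual ⁻¹' JIrr Lᵒᵈ := by
  ext a
  constructor
  · rintro ⟨y, hy, hu⟩
    exact ⟨OrderDual.toDual y, hy.toDual, fun z hz => hu (OrderDual.ofDual z) hz.ofDual⟩
  · rintro ⟨y, hy, hu⟩
    exact ⟨OrderDual.ofDual y, hy.ofDual, fun z hz => hu (OrderDual.toDual z) hz.toDual⟩

theorem exists_mem_MIrr_le_not_le [Finite L] {a b : L} (h : ¬a ≤ b) :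
    ∃ c ∈ MIrr L, b ≤ c ∧ ¬a ≤ c := by
  obtain ⟨j, hj, h₁, h₂⟩ :=
    exists_mem_JIrr_le_not_le (L := Lᵒᵈ) (a := OrderDual.toDual b) (b := OrderDual.toDual a) h
  exact ⟨OrderDual.ofDual j, by rw [MIrr_eq_JIrr_dual]; exact hj, h₁, h₂⟩

/-- Every join-irreducible element belongs to each family that separates elements from below. -/
theorem JIrr_subset_range [Finite L] {ι : Type v} {j : ι → L}
    (hj : ∀ a b, ¬a ≤ b → ∃ i, j i ≤ a ∧ ¬j i ≤ b) : JIrr L ⊆ Set.range j := by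
  rintro p ⟨y, hy, hu⟩
  -- A member that separates `p` from its only lower cover must be `p` itself.
  obtain ⟨i, hi, hiy⟩ := hj p y hy.lt.not_ge
  refine ⟨i, hi.eq_of_not_lt fun hlt => ?_⟩
  obtain ⟨z, hz, hzp⟩ := exists_le_covBy_of_lt hlt
  exact hiy (hu z hzp ▸ hz)

theorem MIrr_subset_range [Finite L] {ι : Type v} {m : ι → L}
    (hm : ∀ a b, ¬a ≤ b → ∃ i, b ≤ m i ∧ ¬a ≤ m i) : MIrr L ⊆ Set.range m := by
  rintro p ⟨y, hy, hu⟩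
  obtain ⟨i, hi, hiy⟩ := hm y p hy.lt.not_ge
  refine ⟨i, (hi.eq_of_not_lt fun hlt => ?_).symm⟩
  obtain ⟨z, hpz, hz⟩ := exists_covBy_le_of_lt hlt
  exact hiy (hu z hpz ▸ hz)

/-- Along a chain, the set of join-irreducibles below the current element grows strictly. -/
theorem krullDim_le_ncard_JIrr [Finite L] :
    Order.krullDim L ≤ ((JIrr L).ncard : WithBot ℕ∞) := by
  refine iSup_le fun p => ?_
  let f : Fin (p.length + 1) → ℕ := fun i => {j ∈ JIrr L | j ≤ p i}.ncard
  have hf : StrictMono f := by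
    intro i k hik
    refine Set.ncard_lt_ncard ?_ (Set.toFinite _)
    have hlt : p i < p k := p.strictMono hik
    obtain ⟨j, hj, h₁, h₂⟩ := exists_mem_JIrr_le_not_le hlt.not_ge
    exact ⟨fun x hx => ⟨hx.1, hx.2.trans hlt.le⟩, fun hs => h₂ (hs ⟨hj, h₁⟩).2⟩
  have hle : ∀ i : Fin (p.length + 1), (i : ℕ) ≤ f i := by
    intro i
    induction i using Fin.induction with
    | zero => exact Nat.zero_le _
    | succ i ih =>
      have := hf (Fin.castSucc_lt_succ (i := i))
      simp only [Fin.val_castSucc, Fin.val_succ] at ih ⊢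
      omega
  have h := (hle (Fin.last _)).trans
    (Set.ncard_le_ncard (fun x hx => hx.1) (Set.toFinite (JIrr L)))
  exact_mod_cast h

theorem krullDim_le_ncard_MIrr [Finite L] :
    Order.krullDim L ≤ ((MIrr L).ncard : WithBot ℕ∞) := by
  have h := krullDim_le_ncard_JIrr (L := Lᵒᵈ)
  rw [Order.krullDim_orderDual] at h
  rwa [MIrr_eq_JIrr_dual,
    Set.ncard_preimage_of_injective_subset_range OrderDual.toDual.injective
      fun x _ => OrderDual.toDual.surjective x]

theorem exists_isLUB_of_finite [Finite L] [Nonempty L] (s : Set L) : ∃ a, IsLUB s a := by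
  classical
  have := Fintype.ofFinite L
  let _ := Fintype.toOrderBot L
  refine ⟨s.toFinset.sup id, fun x hx => Finset.le_sup (f := id) (by simpa using hx), ?_⟩
  intro b hb
  exact Finset.sup_le fun x hx => hb (by simpa using hx)

/-- Each step of the chain acquires a new join-irreducible. With `N` steps and `N`
join-irreducibles, each step accounts for exactly one. -/
theorem exists_numbering_JIrr [Finite L] {N : ℕ} {x : Fin (N + 1) → L} (hx : StrictMono x)
    (hN : (JIrr L).ncard = N) :
    ∃ j : Fin N → L, Function.Injective j ∧ Set.range j = JIrr L ∧
      ∀ i, IsLUB (j '' {k | k.castSucc < i}) (x i) := by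
  have h : ∀ k : Fin N, ∃ j ∈ JIrr L, j ≤ x k.succ ∧ ¬j ≤ x k.castSucc := fun k =>
    exists_mem_JIrr_le_not_le (hx Fin.castSucc_lt_succ).not_ge
  choose j hj hle hnle using h
  have hlt : ∀ k l, k < l → j k ≠ j l := fun k l hkl he =>
    hnle l (he ▸ (hle k).trans (hx.monotone (Fin.succ_le_castSucc_iff.2 hkl)))
  have hinj : Function.Injective j := fun k l he => by
    by_contra hne
    rcases lt_or_gt_of_ne hne with h | h
    exacts [hlt _ _ h he, hlt _ _ h he.symm]
  have hr : Set.range j = JIrr L := by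
    refine Set.eq_of_subset_of_ncard_le (by rintro _ ⟨k, rfl⟩; exact hj k) ?_ (Set.toFinite _)
    rw [hN, ← Set.image_univ, Set.ncard_image_of_injective _ hinj, Set.ncard_univ, Nat.card_fin]
  refine ⟨j, hinj, hr, fun i => ⟨?_, fun b hb => ?_⟩⟩
  · rintro _ ⟨k, hk, rfl⟩
    exact (hle k).trans (hx.monotone (Fin.castSucc_lt_iff_succ_le.1 hk))
  · by_contra hib
    obtain ⟨a, ha, hai, hab⟩ := exists_mem_JIrr_le_not_le hib
    obtain ⟨k, rfl⟩ := hr.symm ▸ ha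
    refine hab (hb ⟨k, ?_, rfl⟩)
    by_contra hk
    exact hnle k (hai.trans (hx.monotone (not_lt.1 hk)))

theorem exists_numbering_MIrr [Finite L] {N : ℕ} {x : Fin (N + 1) → L} (hx : StrictMono x)
    (hN : (MIrr L).ncard = N) :
    ∃ m : Fin N → L, Function.Injective m ∧ Set.range m = MIrr L ∧
      ∀ i, IsGLB (m '' {k | i ≤ k.castSucc}) (x i) := by
  have h : ∀ k : Fin N, ∃ m ∈ MIrr L, x k.castSucc ≤ m ∧ ¬x k.succ ≤ m := fun k =>
    exists_mem_MIrr_le_not_le (hx Fin.castSucc_lt_succ).not_ge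
  choose m hm hle hnle using h
  have hlt : ∀ k l, k < l → m k ≠ m l := fun k l hkl he =>
    hnle k (he ▸ (hx.monotone (Fin.succ_le_castSucc_iff.2 hkl)).trans (hle l))
  have hinj : Function.Injective m := fun k l he => by
    by_contra hne
    rcases lt_or_gt_of_ne hne with h | h
    exacts [hlt _ _ h he, hlt _ _ h he.symm]
  have hr : Set.range m = MIrr L := by
    refine Set.eq_of_subset_of_ncard_le (by rintro _ ⟨k, rfl⟩; exact hm k) ?_ (Set.toFinite _)
    rw [hN, ← Set.image_univ, Set.ncard_image_of_injective _ hinj, Set.ncard_univ, Nat.card_fin]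
  refine ⟨m, hinj, hr, fun i => ⟨?_, fun b hb => ?_⟩⟩
  · rintro _ ⟨k, hk, rfl⟩
    exact (hx.monotone hk).trans (hle k)
  · by_contra hib
    obtain ⟨a, ha, hai, hab⟩ := exists_mem_MIrr_le_not_le hib
    obtain ⟨k, rfl⟩ := hr.symm ▸ ha
    refine hab (hb ⟨k, ?_, rfl⟩)
    by_contra hk
    exact hnle k ((hx.monotone (Fin.castSucc_lt_iff_succ_le.1 (not_le.1 hk))).trans hai)

theorem IsExtremal.exists_chainNumbering [Finite L] (h : IsExtremal L) :
    ∃ N, Nonempty (ChainNumbering L N) := by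
  have : FiniteDimensionalOrder L :=
    Order.finiteDimensionalOrder_iff_krullDim_ne_bot_and_top.2
      ⟨fun hb => by simp [h.1] at hb, fun ht => by
        rw [h.1] at ht
        exact ENat.natCast_ne_top _ (WithBot.coe_injective ht)⟩
  have hN := Order.krullDim_eq_length_of_finiteDimensionalOrder (α := L)
  set p := LTSeries.longestOf L
  have hJ : (JIrr L).ncard = p.length := by
    have := h.1.symm.trans hN
    exact_mod_cast this
  have hM : (MIrr L).ncard = p.length := by
    have := h.2.symm.trans hN
    exact_mod_cast this
  obtain ⟨j, hji, hjr, hj⟩ := exists_numbering_JIrr p.strictMono hJ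
  obtain ⟨m, hmi, hmr, hm⟩ := exists_numbering_MIrr p.strictMono hM
  exact ⟨p.length, ⟨⟨p, p.strictMono, hN, j, hji, hjr, m, hmi, hmr, hj, hm⟩⟩⟩

/-- Two families of elements that separate from below and from above and whose incidence relation
is triangular make a finite lattice extremal and are numberings given by a longest chain. -/
theorem exists_chainNumbering_of_triangular [Finite L] [Nonempty L] {N : ℕ} {j m : Fin N → L}
    (hj : ∀ a b, ¬a ≤ b → ∃ i, j i ≤ a ∧ ¬j i ≤ b) (hm : ∀ a b, ¬a ≤ b → ∃ i, b ≤ m i ∧ ¬a ≤ m i)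
    (hlt : ∀ i k, i < k → j i ≤ m k) (hdiag : ∀ k, ¬j k ≤ m k) :
    IsExtremal L ∧ ∃ c : ChainNumbering L N, c.join = j ∧ c.meet = m := by
  choose x hx using fun i : Fin (N + 1) =>
    exists_isLUB_of_finite (j '' {k | k.castSucc < i})
  have hx' : ∀ i, IsGLB (m '' {k | i ≤ k.castSucc}) (x i) := by
    intro i
    constructor
    · rintro _ ⟨k, hk, rfl⟩
      refine (hx i).2 ?_
      rintro _ ⟨l, hl, rfl⟩
      exact hlt l k (Fin.castSucc_lt_castSucc_iff.1 (lt_of_lt_of_le hl hk))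
    · intro b hb
      by_contra hba
      obtain ⟨w, hw, hbw⟩ := hm _ _ hba
      -- If `w` precedes `i`, then `j w ≤ x i ≤ m w` contradicts the diagonal; otherwise `m w` is
      -- among the elements that bound `b`.
      rcases lt_or_ge w.castSucc i with h | h
      · exact hdiag w (((hx i).1 ⟨w, h, rfl⟩).trans hw)
      · exact hbw (hb ⟨w, h, rfl⟩)
  have hmono : StrictMono x := by
    rw [Fin.strictMono_iff_lt_succ]
    intro k
    refine lt_of_le_not_ge ((hx _).mono (hx _) (Set.image_mono fun l hl =>
      lt_trans hl Fin.castSucc_lt_succ)) fun h => hdiag k ?_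
    exact ((hx k.succ).1 ⟨k, Fin.castSucc_lt_succ, rfl⟩).trans
      (h.trans ((hx' k.castSucc).1 ⟨k, le_refl k.castSucc, rfl⟩))
  have hle : (N : WithBot ℕ∞) ≤ Order.krullDim L := by
    exact le_iSup (fun p : LTSeries L => (p.length : WithBot ℕ∞)) (LTSeries.mk N x hmono)
  have hcard : ∀ f : Fin N → L, (Set.range f).ncard ≤ N := fun f => by
    rw [← Set.image_univ]
    exact (Set.ncard_image_le (Set.toFinite _)).trans (by rw [Set.ncard_univ, Nat.card_fin])
  -- The chain has length `N`, the length is at most the number of irreducibles of either kind, and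
  -- these lie in families of size at most `N`: all are equalities.
  have hJsub := JIrr_subset_range hj
  have hMsub := MIrr_subset_range hm
  have hJN : N ≤ (JIrr L).ncard := by exact_mod_cast hle.trans krullDim_le_ncard_JIrr
  have hMN : N ≤ (MIrr L).ncard := by exact_mod_cast hle.trans krullDim_le_ncard_MIrr
  have hJ : Set.range j = JIrr L :=
    (Set.eq_of_subset_of_ncard_le hJsub ((hcard j).trans hJN) (Set.toFinite _)).symm
  have hM : Set.range m = MIrr L :=
    (Set.eq_of_subset_of_ncard_le hMsub ((hcard m).trans hMN) (Set.toFinite _)).symm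
  have hJc : (JIrr L).ncard = N := le_antisymm (hJ ▸ hcard j) hJN
  have hMc : (MIrr L).ncard = N := le_antisymm (hM ▸ hcard m) hMN
  have hdim : Order.krullDim L = (N : WithBot ℕ∞) :=
    le_antisymm (hJc ▸ krullDim_le_ncard_JIrr) hle
  have hji : Function.Injective j := by
    intro a b hab
    by_contra hne
    rcases lt_or_gt_of_ne hne with h | h
    · exact hdiag b (hab ▸ hlt a b h)
    · exact hdiag a (hab ▸ hlt b a h)
  have hmi : Function.Injective m := by
    intro a b hab
    by_contra hne
    rcases lt_or_gt_of_ne hne with h | h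
    · exact hdiag a (hab ▸ hlt a b h)
    · exact hdiag b (hab ▸ hlt b a h)
  exact ⟨⟨hJc.symm ▸ hdim, hMc.symm ▸ hdim⟩,
    ⟨x, hmono, hdim, j, hji, hJ, m, hmi, hM, hx, hx'⟩, rfl, rfl⟩

end FiniteLattice

/-! ### Triangular incidence and uniqueness of the pairing -/

namespace ChainNumbering

variable {L : Type u} [Lattice L] {N : ℕ} (c : ChainNumbering L N)

theorem join_le_meet {i k : Fin N} (h : i < k) : c.join i ≤ c.meet k :=
  ((c.isLUB_join i.succ).1 ⟨i, Fin.castSucc_lt_succ, rfl⟩).trans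
    ((c.strictMono_chain.monotone (Fin.succ_le_castSucc_iff.2 h)).trans
      ((c.isGLB_meet k.castSucc).1 ⟨k, le_refl k.castSucc, rfl⟩))

/-- Otherwise every join up to index `k` would lie below every meet from index `k` on, so two
consecutive chain elements would coincide. -/
theorem not_join_le_meet (k : Fin N) : ¬c.join k ≤ c.meet k := by
  intro h
  refine (c.strictMono_chain (Fin.castSucc_lt_succ (i := k))).not_ge
    ((c.isGLB_meet k.castSucc).2 ?_)
  rintro _ ⟨l, hl, rfl⟩
  refine (c.isLUB_join k.succ).2 ?_
  rintro _ ⟨i, hi, rfl⟩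
  have hil : i ≤ l := (Fin.castSucc_lt_succ_iff.1 hi).trans (Fin.castSucc_le_castSucc_iff.1 hl)
  rcases hil.lt_or_eq with h' | rfl
  · exact c.join_le_meet h'
  · have : i = k := le_antisymm (Fin.castSucc_lt_succ_iff.1 hi) (Fin.castSucc_le_castSucc_iff.1 hl)
    exact this ▸ h

theorem exists_join_eq {a : L} (ha : a ∈ JIrr L) : ∃ i, c.join i = a := by
  rwa [← c.range_join] at ha

theorem join_mem (i : Fin N) : c.join i ∈ JIrr L := c.range_join ▸ Set.mem_range_self i

/-- The pairing of the join-irreducibles with the meet-irreducibles does not depend on the chain. -/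
theorem meet_eq_meet {N' : ℕ} (c' : ChainNumbering L N') {i : Fin N} {i' : Fin N'}
    (h : c'.join i' = c.join i) : c'.meet i' = c.meet i := by
  have h₁ : ∀ i, ∃ i', c'.join i' = c.join i := fun i => c'.exists_join_eq (c.join_mem i)
  choose f hf using h₁
  have h₂ : ∀ i', ∃ i, c.meet i = c'.meet i' := fun i' => by
    have : c'.meet i' ∈ Set.range c.meet := by
      rw [c.range_meet, ← c'.range_meet]
      exact Set.mem_range_self i'
    exact this
  choose g hg using h₂
  have hfi : Function.Injective f := fun a b hab =>
    c.join_injective (by rw [← hf a, ← hf b, hab])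
  have hgi : Function.Injective g := fun a b hab =>
    c'.meet_injective (by rw [← hg a, ← hg b, hab])
  -- The first numbering is triangular and the second fails incidence on its diagonal, so `g ∘ f`
  -- never raises an index; being injective, it is the identity.
  have hle : ∀ i, g (f i) ≤ i := by
    intro i
    by_contra hi
    have := c.join_le_meet (not_le.1 hi)
    rw [hg, ← hf i] at this
    exact c'.not_join_le_meet _ this
  have hid : ∀ i, g (f i) = i := by
    intro i
    induction i using WellFoundedLT.induction with
    | ind i ih =>
      refine (hle i).eq_of_not_lt fun hlt => hlt.ne ?_
      exact hfi (hgi (ih _ hlt))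
  have : i' = f i := c'.join_injective (by rw [h, hf])
  rw [this, ← hg, hid]

theorem galoisGraph_adj_iff {a b : JIrr L} {i k : Fin N} (ha : c.join i = a) (hb : c.join k = b) :
    (galoisGraph L).Adj a b ↔ i ≠ k ∧ ¬c.join i ≤ c.meet k := by
  constructor
  · rintro ⟨N', c', i', k', ha', hb', hne, hle⟩
    rw [c.meet_eq_meet c' (hb'.trans hb.symm), ha'.trans ha.symm] at hle
    refine ⟨?_, hle⟩
    rintro rfl
    exact hne (c'.join_injective (by rw [ha', hb', ← ha, ← hb]))
  · rintro ⟨hne, hle⟩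
    exact ⟨N, c, i, k, ha, hb, hne, hle⟩

end ChainNumbering

/-! ### Lattices of maximal orthogonal pairs -/

namespace MaxOrthPair

variable {V : Type v} {G : Digraph V}

instance [Finite V] : Finite (MaxOrthPair G) := Subtype.finite

theorem upperPolar_fst (p : MaxOrthPair G) : upperPolar (Rel G) p.1.1 = p.1.2 :=
  ((maximal_iff p.1).1 p.2).1

theorem lowerPolar_snd (p : MaxOrthPair G) : lowerPolar (Rel G) p.1.2 = p.1.1 :=
  ((maximal_iff p.1).1 p.2).2

theorem mem_fst_iff (p : MaxOrthPair G) {v : V} : v ∈ p.1.1 ↔ ∀ w ∈ p.1.2, Rel G v w := by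
  conv_lhs => rw [← p.lowerPolar_snd]
  exact ⟨fun h w hw => h hw, fun h w hw => h w hw⟩

theorem mem_snd_iff (p : MaxOrthPair G) {w : V} : w ∈ p.1.2 ↔ ∀ v ∈ p.1.1, Rel G v w := by
  conv_lhs => rw [← p.upperPolar_fst]
  exact ⟨fun h v hv => h hv, fun h v hv => h v hv⟩

theorem le_iff_fst {p q : MaxOrthPair G} : p ≤ q ↔ p.1.1 ⊆ q.1.1 := Iff.rfl

theorem le_iff_snd {p q : MaxOrthPair G} : p ≤ q ↔ q.1.2 ⊆ p.1.2 := by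
  constructor
  · intro h w hw
    exact p.mem_snd_iff.2 fun v hv => q.mem_snd_iff.1 hw v (h hv)
  · intro h v hv
    exact q.mem_fst_iff.2 fun w hw => p.mem_fst_iff.1 hv w (h hw)

theorem exists_not_rel_of_not_le {p q : MaxOrthPair G} (h : ¬p ≤ q) :
    ∃ v ∈ p.1.1, ∃ w ∈ q.1.2, ¬Rel G v w := by
  obtain ⟨v, hv, hvq⟩ := Set.not_subset.1 h
  rw [mem_fst_iff] at hvq
  push Not at hvq
  exact ⟨v, hv, hvq⟩

variable (G) in
/-- The smallest maximal orthogonal pair whose first set contains the given set. -/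
def generatedBy (A : Set V) : MaxOrthPair G :=
  ⟨(lowerPolar (Rel G) (upperPolar (Rel G) A), upperPolar (Rel G) A),
    (maximal_iff _).2 ⟨upperPolar_lowerPolar_upperPolar _ _, rfl⟩⟩

variable (G) in
/-- The largest maximal orthogonal pair whose second set contains the given set. -/
def cogeneratedBy (B : Set V) : MaxOrthPair G :=
  ⟨(lowerPolar (Rel G) B, upperPolar (Rel G) (lowerPolar (Rel G) B)),
    (maximal_iff _).2 ⟨rfl, lowerPolar_upperPolar_lowerPolar _ _⟩⟩

instance : Nonempty (MaxOrthPair G) := ⟨generatedBy G ∅⟩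

theorem generatedBy_singleton_le_iff {v : V} {p : MaxOrthPair G} :
    generatedBy G {v} ≤ p ↔ v ∈ p.1.1 := by
  rw [le_iff_snd, mem_fst_iff]
  simp [generatedBy, Set.subset_def, upperPolar]

theorem le_cogeneratedBy_singleton_iff {w : V} {p : MaxOrthPair G} :
    p ≤ cogeneratedBy G {w} ↔ w ∈ p.1.2 := by
  rw [le_iff_fst, mem_snd_iff]
  simp [cogeneratedBy, Set.subset_def, lowerPolar]

theorem generatedBy_singleton_le_cogeneratedBy_singleton_iff {v w : V} :
    generatedBy G {v} ≤ cogeneratedBy G {w} ↔ Rel G v w := by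
  rw [generatedBy_singleton_le_iff]
  simp [cogeneratedBy, lowerPolar]

/-- A finite lattice with two separating families whose incidence relation is `Rel G` is the lattice
of maximal orthogonal pairs of `G`. -/
theorem nonempty_orderIso {L : Type u} [Lattice L] [Finite L] [Nonempty L] {j m : V → L}
    (hj : ∀ a b, ¬a ≤ b → ∃ v, j v ≤ a ∧ ¬j v ≤ b) (hm : ∀ a b, ¬a ≤ b → ∃ v, b ≤ m v ∧ ¬a ≤ m v)
    (h : ∀ v w, j v ≤ m w ↔ Rel G v w) : Nonempty (L ≃o MaxOrthPair G) := by
  have hj' : ∀ {a b}, (∀ v, j v ≤ a → j v ≤ b) → a ≤ b := fun {a b} hab => by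
    by_contra hn
    obtain ⟨v, h₁, h₂⟩ := hj _ _ hn
    exact h₂ (hab v h₁)
  have hm' : ∀ {a b}, (∀ v, b ≤ m v → a ≤ m v) → a ≤ b := fun {a b} hab => by
    by_contra hn
    obtain ⟨v, h₁, h₂⟩ := hm _ _ hn
    exact h₂ (hab v h₁)
  have hmax : ∀ a : L, Maximal (IsOrthogonal G) ({v | j v ≤ a}, {v | a ≤ m v}) := by
    intro a
    rw [maximal_iff]
    refine ⟨Set.ext fun w => ⟨fun hw => ?_, fun hw v hv => ?_⟩,
      Set.ext fun v => ⟨fun hv => ?_, fun hv w hw => ?_⟩⟩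
    · exact hj' fun v hv => (h v w).2 (hw hv)
    · exact (h v w).1 (le_trans hv hw)
    · exact hm' fun w hw => (h v w).2 (hv hw)
    · exact (h v w).1 (le_trans hv hw)
  let f : L ↪o MaxOrthPair G := OrderEmbedding.ofMapLEIff (fun a => ⟨_, hmax a⟩) fun a b =>
    ⟨fun hab => hj' fun v hv => hab hv, fun hab v hv => le_trans hv hab⟩
  refine ⟨RelIso.ofSurjective f fun p => ?_⟩
  -- A preimage of `p` is the join of the `j v` with `v` in its first set; the second sets agree
  -- because `a ≤ m w` tests only these `v`.
  obtain ⟨a, ha⟩ := exists_isLUB_of_finite (j '' p.1.1)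
  refine ⟨a, (equivConcept G).injective (Concept.ext' ?_)⟩
  refine Set.ext fun w => Iff.trans ?_ p.mem_snd_iff.symm
  change a ≤ m w ↔ _
  rw [isLUB_le_iff ha]
  simp [upperBounds, h]

end MaxOrthPair

/-! ### Extremal lattices and acyclic graphs -/

/-- For each function to `ℕ`, a finite type has a numbering along which it is monotone. -/
theorem exists_numbering_monotone {V : Type v} [Finite V] (f : V → ℕ) :
    ∃ e : Fin (Nat.card V) ≃ V, Monotone (f ∘ e) :=
  ⟨(Tuple.sort (f ∘ (Finite.equivFin V).symm)).trans (Finite.equivFin V).symm,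
    Tuple.monotone_sort (f ∘ (Finite.equivFin V).symm)⟩

namespace MaxOrthPair

variable {V : Type v} {G : Digraph V}

/-- The lattice of maximal orthogonal pairs of a finite acyclic directed graph is extremal, and the
graph is its Galois graph. -/
theorem isExtremal_and_galoisGraph [Finite V] (f : V → ℕ)
    (hf : ∀ v w, G.Adj v w → f w < f v) (hG : ∀ v, ¬G.Adj v v) :
    IsExtremal (MaxOrthPair G) ∧
      Nonempty ((galoisGraph (MaxOrthPair G)).Adj ≃r G.Adj) := by
  obtain ⟨e, he⟩ := exists_numbering_monotone f
  obtain ⟨hext, c, hcj, hcm⟩ := exists_chainNumbering_of_triangular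
    (j := fun i => generatedBy G {e i}) (m := fun i => cogeneratedBy G {e i})
    (fun a b hab => by
      obtain ⟨v, hv, hv'⟩ := Set.not_subset.1 hab
      refine ⟨e.symm v, ?_, ?_⟩ <;>
        simpa only [e.apply_symm_apply, generatedBy_singleton_le_iff])
    (fun a b hab => by
      obtain ⟨v, hv, hv'⟩ := Set.not_subset.1 fun h => hab (le_iff_snd.2 h)
      refine ⟨e.symm v, ?_, ?_⟩ <;>
        simpa only [e.apply_symm_apply, le_cogeneratedBy_singleton_iff])
    (fun i k hik => by
      rw [generatedBy_singleton_le_cogeneratedBy_singleton_iff]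
      -- Edges strictly decrease `f`, so none goes from an earlier to a later vertex.
      exact ⟨fun h => hik.ne (e.injective h), fun h => (hf _ _ h).not_ge (he hik.le)⟩)
    (fun k => by
      rw [generatedBy_singleton_le_cogeneratedBy_singleton_iff]
      exact fun h => h.1 rfl)
  refine ⟨hext, ⟨RelIso.symm ⟨e.symm.trans (Equiv.ofBijective (fun i => ⟨c.join i, c.join_mem i⟩)
    ⟨fun a b hab => c.join_injective (Subtype.ext_iff.1 hab), fun a => ?_⟩), ?_⟩⟩⟩
  · obtain ⟨i, hi⟩ := c.exists_join_eq a.2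
    exact ⟨i, Subtype.ext hi⟩
  · intro v w
    refine (c.galoisGraph_adj_iff (i := e.symm v) (k := e.symm w) rfl rfl).trans ?_
    simp only [hcj, hcm, e.apply_symm_apply,
      generatedBy_singleton_le_cogeneratedBy_singleton_iff, Rel, ne_eq, e.symm.injective.eq_iff]
    constructor
    · rintro ⟨h, h'⟩
      by_contra hn
      exact h' ⟨h, hn⟩
    · intro h
      refine ⟨?_, fun h' => h'.2 h⟩
      rintro rfl
      exact hG _ h

end MaxOrthPair

/-- A finite extremal lattice is the lattice of maximal orthogonal pairs of its Galois graph. -/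
theorem IsExtremal.nonempty_orderIso {L : Type u} [Lattice L] [Finite L] (hL : IsExtremal L)
    {V : Type v} {G : Digraph V} (φ : (galoisGraph L).Adj ≃r G.Adj) :
    Nonempty (L ≃o MaxOrthPair G) := by
  obtain ⟨N, ⟨c⟩⟩ := hL.exists_chainNumbering
  have : Nonempty L := ⟨c.chain 0⟩
  choose i hi using fun v : V => c.exists_join_eq (φ.symm v).2
  have hii : ∀ v w, i v = i w ↔ v = w := fun v w =>
    ⟨fun h => φ.symm.injective (Subtype.ext (by rw [← hi v, ← hi w, h])), fun h => h ▸ rfl⟩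
  have hsurj : ∀ k, ∃ v, i v = k := fun k =>
    ⟨φ ⟨c.join k, c.join_mem k⟩, c.join_injective (by rw [hi, φ.symm_apply_apply])⟩
  refine MaxOrthPair.nonempty_orderIso (j := fun v => c.join (i v)) (m := fun v => c.meet (i v))
    (fun a b hab => ?_) (fun a b hab => ?_) fun v w => ?_
  · obtain ⟨x, hx, h⟩ := exists_mem_JIrr_le_not_le hab
    obtain ⟨k, rfl⟩ := c.exists_join_eq hx
    obtain ⟨v, rfl⟩ := hsurj k
    exact ⟨v, h⟩
  · obtain ⟨x, hx, h⟩ := exists_mem_MIrr_le_not_le hab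
    obtain ⟨k, rfl⟩ := c.range_meet.symm ▸ hx
    obtain ⟨v, rfl⟩ := hsurj k
    exact ⟨v, h⟩
  · have h := c.galoisGraph_adj_iff (hi v) (hi w)
    rw [φ.symm.map_rel_iff, ne_eq, hii] at h
    unfold MaxOrthPair.Rel
    rw [h]
    constructor
    · intro hle
      refine ⟨?_, fun h' => h'.2 hle⟩
      rintro rfl
      exact c.not_join_le_meet _ hle
    · rintro ⟨hne, h'⟩
      by_contra hn
      exact h' ⟨hne, hn⟩

/-! ### Bounds on the order dimension -/

theorem HasOrderDim.of_orderIso {P : Type u} {Q : Type v} [PartialOrder P] [PartialOrder Q]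
    {d : ℕ} (e : P ≃o Q) (h : HasOrderDim Q d) : HasOrderDim P d :=
  ⟨h.1.map fun f => e.toOrderEmbedding.trans f,
    fun _ hk => h.2 (Nonempty.map (fun f => e.symm.toOrderEmbedding.trans f) hk)⟩

/-- The order dimension of a poset that contains a standard example is at least its size. -/
theorem card_le_of_standardExample {P : Type u} [PartialOrder P] {ι : Type v} [Fintype ι] {k : ℕ}
    (f : P ↪o (Fin k → ℝ)) (a b : ι → P) (hle : ∀ i i', i ≠ i' → a i ≤ b i')
    (hnle : ∀ i, ¬a i ≤ b i) : Fintype.card ι ≤ k := by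
  have h : ∀ i, ∃ c, f (b i) c < f (a i) c := by
    intro i
    by_contra hn
    push Not at hn
    exact hnle i (f.le_iff_le.1 hn)
  choose c hc using h
  have hinj : Function.Injective c := by
    intro i i' hii
    -- A coordinate shared by `i` and `i'` would give the cycle `a i ≤ b i' < a i' ≤ b i < a i`.
    by_contra hne
    have h₁ := f.le_iff_le.2 (hle i i' hne) (c i)
    have h₂ := f.le_iff_le.2 (hle i' i (Ne.symm hne)) (c i)
    have h₃ := hc i
    have h₄ := hc i'
    rw [← hii] at h₄
    linarith
  simpa using Fintype.card_le_of_injective c hinj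

namespace MaxOrthPair

variable {V : Type v} {G : Digraph V}

/-- If the complement of `Rel G` is the union of `d` relations whose rows are nested (Ferrers
relations), then the lattice of maximal orthogonal pairs embeds in `ℝᵈ`. -/
theorem nonempty_orderEmbedding_of_ferrers [Finite V] {ι : Type u} (F : ι → V → Set V)
    (hF : ∀ i v v', F i v ⊆ F i v' ∨ F i v' ⊆ F i v)
    (hcover : ∀ v w, ¬Rel G v w ↔ ∃ i, w ∈ F i v) :
    Nonempty (MaxOrthPair G ↪o (ι → ℝ)) := by
  let g : MaxOrthPair G → ι → Set V := fun p i => ⋃ v ∈ p.1.1, F i v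
  refine ⟨OrderEmbedding.ofMapLEIff (fun p i => ((g p i).ncard : ℝ)) fun p q => ⟨fun h => ?_,
    fun h i => ?_⟩⟩
  · by_contra hpq
    obtain ⟨v, hv, w, hw, hvw⟩ := exists_not_rel_of_not_le hpq
    obtain ⟨i, hi⟩ := (hcover v w).1 hvw
    -- Orthogonality of `q` keeps `w` out of its rows. By nestedness these rows lie inside `F i v`,
    -- which contains `w`, so coordinate `i` of `q` is strictly smaller than that of `p`.
    have hnot : ∀ v' ∈ q.1.1, w ∉ F i v' := fun v' hv' hwv' =>
      (hcover v' w).2 ⟨i, hwv'⟩ (q.mem_fst_iff.1 hv' w hw)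
    refine (Set.ncard_lt_ncard (s := g q i) (t := g p i) ⟨?_, ?_⟩ (Set.toFinite _)).not_ge
      (Nat.cast_le.1 (h i))
    · refine Set.iUnion₂_subset fun v' hv' => ?_
      refine ((hF i v' v).resolve_right fun hs => hnot v' hv' (hs hi)).trans ?_
      exact Set.subset_biUnion_of_mem (u := F i) hv
    · intro hs
      obtain ⟨v', hv', hwv'⟩ := Set.mem_iUnion₂.1 (hs (Set.mem_biUnion hv hi))
      exact hnot v' hv' hwv'
  · exact Nat.cast_le.2 (Set.ncard_le_ncard (Set.biUnion_subset_biUnion_left h) (Set.toFinite _))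

end MaxOrthPair

/-! ### The bubble graph -/

/-- The sum of the three parts of the vertex set. -/
def Vertex.equivSum (m n : ℕ) : Vertex m n ≃ Fin m ⊕ Fin n ⊕ Fin m × Fin n where
  toFun
    | .x s => .inl s
    | .y t => .inr (.inl t)
    | .xy s t => .inr (.inr (s, t))
  invFun
    | .inl s => .x s
    | .inr (.inl t) => .y t
    | .inr (.inr (s, t)) => .xy s t
  left_inv v := by cases v <;> rfl
  right_inv v := by rcases v with _ | _ | _ <;> rfl

instance (m n : ℕ) : Finite (Vertex m n) := Finite.of_equiv _ (Vertex.equivSum m n).symm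

/-- A height function along which the edges of the bubble graph decrease. -/
def Vertex.height {m n : ℕ} : Vertex m n → ℕ
  | .x _ => 0
  | .xy s t => 1 + s + (n - t)
  | .y _ => 2 + m + n

theorem bubbleGraph_height_lt {m n : ℕ} {v w : Vertex m n} (h : (bubbleGraph m n).Adj v w) :
    w.height < v.height := by
  obtain ⟨hne, ⟨s, t, rfl, rfl⟩ | ⟨s, t, rfl, rfl⟩ | ⟨s, t, s', t', rfl, rfl, hs, ht⟩⟩ := h
  · simp only [Vertex.height]; omega
  · simp only [Vertex.height]; omega
  · have : ¬((s : ℕ) = s' ∧ (t : ℕ) = t') := fun h =>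
      hne (by rw [Fin.ext h.1, Fin.ext h.2])
    have hs' : (s' : ℕ) ≤ s := hs
    have ht' : (t : ℕ) ≤ t' := ht
    simp only [Vertex.height]
    omega

theorem isBubbleLattice_bub (m n : ℕ) : IsBubbleLattice m n (Bub m n) := by
  have h := MaxOrthPair.isExtremal_and_galoisGraph (G := bubbleGraph m n) Vertex.height
    (fun _ _ => bubbleGraph_height_lt) fun _ hv => hv.1 rfl
  exact ⟨inferInstance, h.1, h.2⟩

/-- The rows of the Ferrers relations that cover the complement of the incidence relation of the
bubble lattice: one relation for each letter. -/
def ferrersRow {m n : ℕ} : Fin m ⊕ Fin n → Vertex m n → Set (Vertex m n)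
  | .inl s, .x s' => {w | s' = s ∧ w = .x s}
  | .inl s, .xy s' t => {w | s' = s ∧ (w = .x s ∨ ∃ s₁ t₁, w = .xy s₁ t₁ ∧ s₁ ≤ s ∧ t ≤ t₁)}
  | .inl _, .y _ => ∅
  | .inr _, .x _ => ∅
  | .inr _, .xy _ _ => ∅
  | .inr t, .y t' => {w | t' = t ∧ (w = .y t ∨ ∃ s, w = .xy s t)}

/-- For a letter `x s`, every nonempty row contains `x s`, and the rows of the `xy s t` shrink as
`t` grows. For a letter `y t`, only one row is nonempty. -/
theorem ferrersRow_total {m n : ℕ} (i : Fin m ⊕ Fin n) (v v' : Vertex m n) :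
    ferrersRow i v ⊆ ferrersRow i v' ∨ ferrersRow i v' ⊆ ferrersRow i v := by
  rcases i with s | t <;> rcases v with s₁ | t₁ | ⟨s₁, t₁⟩ <;>
    rcases v' with s₂ | t₂ | ⟨s₂, t₂⟩ <;> simp only [ferrersRow, Set.subset_def]
  case inl.xy.xy =>
    rcases le_total t₁ t₂ with h | h <;> grind
  all_goals grind

/-- `Rel` also fails on the diagonal. The relation of `x s` takes the diagonal pairs and edges
starting at `x s` or some `xy s t`; the relation of `y t` takes those starting at `y t`. -/
theorem not_rel_bubbleGraph_iff {m n : ℕ} (v w : Vertex m n) :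
    ¬MaxOrthPair.Rel (bubbleGraph m n) v w ↔ ∃ i, w ∈ ferrersRow i v := by
  rcases v with s₁ | t₁ | ⟨s₁, t₁⟩ <;> rcases w with s₂ | t₂ | ⟨s₂, t₂⟩ <;>
    simp [ferrersRow, MaxOrthPair.Rel, bubbleGraph] <;> grind

theorem hasOrderDim_bub (m n : ℕ) : HasOrderDim (Bub m n) (m + n) := by
  constructor
  · obtain ⟨f⟩ := MaxOrthPair.nonempty_orderEmbedding_of_ferrers (G := bubbleGraph m n)
      ferrersRow ferrersRow_total not_rel_bubbleGraph_iff
    refine ⟨f.trans (OrderEmbedding.ofMapLEIff (fun x k => x (finSumFinEquiv.symm k)) ?_)⟩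
    exact fun a b => ⟨fun h i => by simpa using h (finSumFinEquiv i), fun h k => h _⟩
  · rintro k ⟨f⟩
    -- Distinct letters are joined by no edge, hence are incident, while no letter is incident to
    -- itself: a standard example.
    let ι : Fin m ⊕ Fin n → Vertex m n := Sum.elim .x .y
    have h := card_le_of_standardExample f
      (fun i => MaxOrthPair.generatedBy (bubbleGraph m n) {ι i})
      (fun i => MaxOrthPair.cogeneratedBy (bubbleGraph m n) {ι i}) ?_ ?_
    · simpa using h
    · intro i i' hii
      rw [MaxOrthPair.generatedBy_singleton_le_cogeneratedBy_singleton_iff]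
      rcases i with s | t <;> rcases i' with s' | t' <;>
        simp_all [ι, MaxOrthPair.Rel, bubbleGraph]
    · intro i
      rw [MaxOrthPair.generatedBy_singleton_le_cogeneratedBy_singleton_iff]
      exact fun h => h.1 rfl

end BubbleLattices

theorem mainTheorem10 (m n : ℕ) :
    (BubbleLattices.IsBubbleLattice m n (BubbleLattices.Bub m n) ∧
      BubbleLattices.HasOrderDim (BubbleLattices.Bub m n) (m + n)) ∧
    ∀ (L : Type*) [Lattice L], BubbleLattices.IsBubbleLattice m n L →
      BubbleLattices.HasOrderDim L (m + n) := by
  refine ⟨⟨BubbleLattices.isBubbleLattice_bub m n, BubbleLattices.hasOrderDim_bub m n⟩, ?_⟩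
  intro L _ hL
  have := hL.finite
  obtain ⟨φ⟩ := hL.galois
  obtain ⟨e⟩ := hL.extremal.nonempty_orderIso φ
  exact (BubbleLattices.hasOrderDim_bub m n).of_orderIso e
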